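/- Let $n,k,j,\ell$ be integers with $0\le k\le n$, $0\le j<n$, $\ell\ge 1$, and let $X\in\mathbb{R}^{n\times\ell}$ be fixed. Let $\bar a_1,\bar a_2,\ldots\in\mathbb{R}^{n}$ and $\bar b_1,\bar b_2,\ldots\in\mathbb{R}^{\ell}$ be deterministic with $\bar a_i^\top X=\bar b_i^\top$ for all $i$. For $m>j$ let $\bar A$ and $\bar B$ be the matrices with rows $\bar a_i^\top$ and $\bar b_i^\top$, $1\le i\le m$, and write $$\bar C=[\bar A\ \ \bar B]=\begin{bmatrix}\bar C_{\rm upper}\\ \bar C_{\rm lower}\end{bmatrix}=\begin{bmatrix}\bar C_{11}&\bar C_{12}\\ \bar C_{21}&\bar C_{22}\end{bmatrix},\qquad \bar C_{11}\in\mathbb{R}^{j\times k},\quad \bar C_{22}\in\mathbb{R}^{(m-j)\times(n-k+\ell)}.$$ The first $j$ rows and the first $k$ columns are observed without noise: the observed lower block is $C_{\rm lower}=[C_{21}\ \ C_{22}]$ with $C_{21}=\bar C_{21}$ and $C_{22}=\bar C_{22}+E$, where the rows of $E$ are the first $m-j$ terms of a fixed sequence of i.i.d. random row vectors with mean $0$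 and covariance matrix $\sigma^2 I$ ($\sigma$ unknown). Assume that the first $j$ rows of $\bar A$ are linearly independent, and let $P\in\mathbb{R}^{(n+\ell)\times(n+\ell-j)}$ satisfy $P^\top P=I$ and $\bar C_{\rm upper}P=0$. Assume moreover that $\lim_{m\to\infty}m^{-1}\bar C_{21}^\top\bar C_{21}$ exists and is positive definite, and that $\bar S:=\lim_{m\to\infty}m^{-1}\bar C_{\rm lower}^\top\bar C_{\rm lower}$ exists and ${\rm rank}(P^\top\bar S P)=n-j$. For all sufficiently large $m$ (so that $C_{21}^\top C_{21}$ is nonsingular), let $$G=C_{22}^\top C_{22}-C_{22}^\top C_{21}(C_{21}^\top C_{21})^{-1}C_{21}^\top C_{22},$$ let $\lambda_1\le\cdots\le\lambda_\ell$ be the $\ell$ smallest eigenvalues of $G$, counted with multiplicity, let $\mu$ be any number with $\lambda_1\le\mu\le\lambda_\ell$, and let $$F=C_{\rm lower}^\top C_{\rm lower}-\mu\begin{bmatrix}0_{k\times k}&0\\0&I_{n-k+\ell}\end{bmatrix}.$$ Let the columns of $\widetilde Z_\ell\in\mathbb{R}^{(n+\ell-j)\times\ell}$ be linearly independent eigenvectors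 of $P^\top F P$ belonging to its $\ell$ smallest eigenvalues, counted with multiplicity, and let $$Z_\ell=P\widetilde Z_\ell=\begin{bmatrix}Z_{\ell,{\rm upper}}\\ Z_{\ell,{\rm lower}}\end{bmatrix},\qquad Z_{\ell,{\rm upper}}\in\mathbb{R}^{n\times\ell},\quad Z_{\ell,{\rm lower}}\in\mathbb{R}^{\ell\times\ell}.$$ Here $\mu$ and $\widetilde Z_\ell$ may be chosen arbitrarily, subject to the above, for each $m$ and each sample point. Then, for every such choice, with probability one the matrix $Z_{\ell,{\rm lower}}$ is nonsingular for all sufficiently large $m$, and the estimator $\widehat X=-Z_{\ell,{\rm upper}}Z_{\ell,{\rm lower}}^{-1}$ satisfies $$\lim_{m\to\infty}\widehat X=X.$$ -/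

import Mathlib

open Matrix MeasureTheory ProbabilityTheory Filter Topology

namespace EIV

/-- The rows of `[A B]`, where the columns of `A` are split as `k + p` and `B` has `l` columns.
The `i`-th row of `A` is `A i`, the `i`-th row of `B` is `B i` (`i = 0, 1, 2, …`); the columns of
`[A B]` are grouped as `k + (p + l)`. -/
def rowsC {k p l : ℕ} (A : ℕ → Fin k ⊕ Fin p → ℝ) (B : ℕ → Fin l → ℝ) :
    ℕ → Fin k ⊕ (Fin p ⊕ Fin l) → ℝ :=
  fun i => Sum.elim (fun s => A i (Sum.inl s)) (Sum.elim (fun s => A i (Sum.inr s)) (B i))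

/-- The block of the first `j` rows. -/
def upperRows {ι : Type*} (j : ℕ) (C : ℕ → ι → ℝ) : Matrix (Fin j) ι ℝ :=
  Matrix.of fun i => C i

/-- The block of the remaining `m - j` rows among the first `m` rows. -/
def lowerRows {ι : Type*} (j m : ℕ) (C : ℕ → ι → ℝ) : Matrix (Fin (m - j)) ι ℝ :=
  Matrix.of fun i => C (j + i)

/-- The observed lower block `C_lower = [C₂₁ C₂₂]` for `m` rows: `C₂₁` is noise-free and
`C₂₂ = C̄₂₂ + E`, where the rows of `E` are `e 0, …, e (m - j - 1)`. -/
def observedLower {k q : Type*} (j m : ℕ) (Cbar : ℕ → k ⊕ q → ℝ) (e : ℕ → q → ℝ) :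
    Matrix (Fin (m - j)) (k ⊕ q) ℝ :=
  lowerRows j m Cbar + Matrix.fromCols 0 (Matrix.of fun i : Fin (m - j) => e i)

/-- `G = C₂₂ᵀ C₂₂ - C₂₂ᵀ C₂₁ (C₂₁ᵀ C₂₁)⁻¹ C₂₁ᵀ C₂₂`. -/
noncomputable def matG {r k q : Type*} [Fintype r] [Fintype k] [DecidableEq k]
    (C : Matrix r (k ⊕ q) ℝ) : Matrix q q ℝ :=
  C.toCols₂ᵀ * C.toCols₂
    - C.toCols₂ᵀ * C.toCols₁ * (C.toCols₁ᵀ * C.toCols₁)⁻¹ * C.toCols₁ᵀ * C.toCols₂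

/-- `F = Cᵀ C - μ diag(0, I)`. -/
def matF {r k q : Type*} [Fintype r] [DecidableEq q]
    (C : Matrix r (k ⊕ q) ℝ) (mu : ℝ) : Matrix (k ⊕ q) (k ⊕ q) ℝ :=
  Matrix.fromBlocks
    (C.toCols₁ᵀ * C.toCols₁) (C.toCols₁ᵀ * C.toCols₂)
    (C.toCols₂ᵀ * C.toCols₁) (C.toCols₂ᵀ * C.toCols₂ - mu • (1 : Matrix q q ℝ))

/-- `lam` and the columns of `V` form a complete system of eigenpairs of the `N × N` matrix `M`:
the eigenvalues are listed in nondecreasing order (so with multiplicity), and the eigenvectors are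
linearly independent. No normalization of the eigenvectors is required. -/
structure IsOrderedEigensystem {ι : Type*} [Fintype ι] {N : ℕ} (M : Matrix ι ι ℝ)
    (lam : Fin N → ℝ) (V : Matrix ι (Fin N) ℝ) : Prop where
  card_eq : Fintype.card ι = N
  monotone : Monotone lam
  linearIndependent : LinearIndependent ℝ V.col
  eigen : ∀ i, M *ᵥ V.col i = lam i • V.col i

/-- `μ` lies between the smallest and the `l`-th smallest eigenvalue of `G`: `λ₁ ≤ μ ≤ λ_l`. -/
def IsShift {p l : ℕ} (hl : 0 < l) (G : Matrix (Fin p ⊕ Fin l) (Fin p ⊕ Fin l) ℝ)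
    (mu : ℝ) : Prop :=
  ∃ (lam : Fin (l + p) → ℝ) (V : Matrix (Fin p ⊕ Fin l) (Fin (l + p)) ℝ),
    IsOrderedEigensystem G lam V ∧
      lam (Fin.castAdd p ⟨0, hl⟩) ≤ mu ∧
      mu ≤ lam (Fin.castAdd p ⟨l - 1, Nat.sub_lt hl Nat.one_pos⟩)

/-- The columns of `Zt` are eigenvectors for the `l` smallest eigenvalues of `Pᵀ F P`. -/
def IsRitzCoordinates {ι : Type*} [Fintype ι] {l d : ℕ} (F : Matrix ι ι ℝ)
    (P : Matrix ι (Fin (l + d)) ℝ) (Zt : Matrix (Fin (l + d)) (Fin l) ℝ) : Prop :=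
  ∃ (lam : Fin (l + d) → ℝ) (V : Matrix (Fin (l + d)) (Fin (l + d)) ℝ),
    IsOrderedEigensystem (Pᵀ * F * P) lam V ∧ Zt = V.submatrix id (Fin.castAdd d)

/-- The first `k + p` rows of a matrix with `k + (p + l)` rows. -/
def upperPart {k p l : ℕ} (Z : Matrix (Fin k ⊕ (Fin p ⊕ Fin l)) (Fin l) ℝ) :
    Matrix (Fin k ⊕ Fin p) (Fin l) ℝ :=
  Z.submatrix (Sum.elim Sum.inl (fun s => Sum.inr (Sum.inl s))) id

/-- The last `l` rows of a matrix with `k + (p + l)` rows. -/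
def lowerPart {k p l : ℕ} (Z : Matrix (Fin k ⊕ (Fin p ⊕ Fin l)) (Fin l) ℝ) :
    Matrix (Fin l) (Fin l) ℝ :=
  Z.submatrix (fun s => Sum.inr (Sum.inr s)) id

/-- `X̂ = - Z_upper Z_lower⁻¹`. -/
noncomputable def estimator {k p l : ℕ} (Z : Matrix (Fin k ⊕ (Fin p ⊕ Fin l)) (Fin l) ℝ) :
    Matrix (Fin k ⊕ Fin p) (Fin l) ℝ :=
  -(upperPart Z * (lowerPart Z)⁻¹)

/-- The random rows `e 0, e 1, …` are i.i.d. with mean `0` and covariance matrix `σ² I`. -/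
structure NoiseAssumption {Ω : Type*} [MeasurableSpace Ω] {q : Type*} [Fintype q] [DecidableEq q]
    (Pr : Measure Ω) (e : ℕ → Ω → q → ℝ) (σ : ℝ) : Prop where
  indep : iIndepFun e Pr
  identDistrib : ∀ i, IdentDistrib (e i) (e 0) Pr Pr
  memLp : ∀ i s, MemLp (fun ω => e i ω s) 2 Pr
  mean : ∀ i s, ∫ ω, e i ω s ∂Pr = 0
  cov : ∀ i s t, covariance (fun ω => e i ω s) (fun ω => e i ω t) Pr
    = (σ ^ 2 • (1 : Matrix q q ℝ)) s t

/-- `lim m⁻¹ C̄₂₁ᵀ C̄₂₁` exists and is positive definite, `lim m⁻¹ C̄_lowerᵀ C̄_lower = S̄` exists,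
and `Pᵀ S̄ P` has rank `d`. -/
def LimitAssumption {k q ρ : Type*} [Fintype k] [Fintype q] [Fintype ρ]
    (j d : ℕ) (Cbar : ℕ → k ⊕ q → ℝ) (P : Matrix (k ⊕ q) ρ ℝ) : Prop :=
  (∃ T : Matrix k k ℝ,
    Tendsto (fun m : ℕ =>
      (m : ℝ)⁻¹ • ((lowerRows j m Cbar).toCols₁ᵀ * (lowerRows j m Cbar).toCols₁)) atTop (𝓝 T) ∧
    T.PosDef) ∧
  ∃ S : Matrix (k ⊕ q) (k ⊕ q) ℝ,
    Tendsto (fun m : ℕ =>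
      (m : ℝ)⁻¹ • ((lowerRows j m Cbar)ᵀ * lowerRows j m Cbar)) atTop (𝓝 S) ∧
    (Pᵀ * S * P).rank = d

end EIV

/-! Let `W = solutionKernel X`, that is [X; -I]. The exact rows annihilate W, so S W = 0. By the
strong law, the Gram matrix of the observed lower block divided by m tends to S + σ² diag(0, I)
(`NoiseAssumption.ae_tendsto_gram`). The noise term sits in the lower right block only, so `matG`
over m tends to G₀ + σ² I, where G₀ is the Schur complement of S: positive semidefinite, and zero on
the l-dimensional range of the lower rows of W. Hence μ/m → σ² for every admissible shift
(`tendsto_shift`), the correction cancels the noise bias, and F/m → S (`tendsto_matF`).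

The rest is deterministic at each sample point. Since W = P(PᵀW), the rank assumption makes
ker(PᵀSP) the range of PᵀW. Let U and L be the upper and lower rows of P. The residual U + XL
vanishes on that kernel, so its square is dominated by the form of PᵀSP
(`exists_mulVec_dotProduct_le_of_ker_le`), which is small on the Ritz space (`eventually_ritz_le`).
A residual small relative to L gives both nonsingularity and the error bound
(`isUnit_det_and_sq_error_le`). Only quadratic forms on spans enter, never convergence of individual
eigenvectors, so arbitrary choices of μ and of the Ritz vectors are harmless. -/

namespace EIV

/-! ### Rayleigh quotients and eigenvalue bounds. -/

section Rayleigh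

variable {ι κ : Type*} [Fintype ι] [Fintype κ]

lemma dotProduct_self_nonneg (v : ι → ℝ) : 0 ≤ v ⬝ᵥ v :=
  Finset.sum_nonneg fun _ _ => mul_self_nonneg _

lemma mulVec_eq_sum_col {ι κ : Type*} [Fintype κ] (V : Matrix ι κ ℝ) (a : κ → ℝ) : V *ᵥ a = ∑ i, a i • V.col i := by
  rw [Matrix.mulVec_eq_sum]
  exact Finset.sum_congr rfl fun i _ => op_smul_eq_smul _ _

lemma mulVec_dotProduct_mulVec (V : Matrix ι κ ℝ) (a b : κ → ℝ) :
    V *ᵥ a ⬝ᵥ V *ᵥ b = ∑ i, ∑ j, a i * b j * (V.col i ⬝ᵥ V.col j) := by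
  rw [mulVec_eq_sum_col, mulVec_eq_sum_col, sum_dotProduct]
  refine Finset.sum_congr rfl fun i _ => ?_
  rw [dotProduct_sum]
  refine Finset.sum_congr rfl fun j _ => ?_
  rw [smul_dotProduct, dotProduct_smul, smul_eq_mul, smul_eq_mul, mul_assoc]

lemma dotProduct_mulVec_comm {M : Matrix ι ι ℝ} (hM : Mᵀ = M) (v w : ι → ℝ) :
    M *ᵥ v ⬝ᵥ w = v ⬝ᵥ M *ᵥ w := by
  rw [dotProduct_mulVec, ← mulVec_transpose, hM]

/-- Rayleigh quotient bound on a span of eigenvectors, which need not be orthogonal. -/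
lemma le_dotProduct_mulVec_of_eigen {M : Matrix ι ι ℝ} (hM : Mᵀ = M) {lam : κ → ℝ}
    {V : Matrix ι κ ℝ} (hV : ∀ i, M *ᵥ V.col i = lam i • V.col i) {c : ℝ} {a : κ → ℝ}
    (ha : ∀ i, a i ≠ 0 → c ≤ lam i) :
    c * (V *ᵥ a ⬝ᵥ V *ᵥ a) ≤ V *ᵥ a ⬝ᵥ M *ᵥ (V *ᵥ a) := by
  have hMV : M *ᵥ (V *ᵥ a) = V *ᵥ fun i => lam i * a i := by
    rw [mulVec_eq_sum_col V, mulVec_eq_sum_col V, mulVec_sum]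
    refine Finset.sum_congr rfl fun i _ => ?_
    rw [mulVec_smul, hV, smul_smul, mul_comm]
  have horth : ∀ i j, lam i ≠ lam j → V.col i ⬝ᵥ V.col j = 0 := by
    intro i j hij
    have h1 := dotProduct_mulVec_comm hM (V.col i) (V.col j)
    rw [hV, hV, smul_dotProduct, dotProduct_smul, smul_eq_mul, smul_eq_mul] at h1
    have h2 : (lam i - lam j) * (V.col i ⬝ᵥ V.col j) = 0 := by linarith
    exact (mul_eq_zero.1 h2).resolve_left (sub_ne_zero.2 hij)
  -- Only pairs with equal eigenvalues contribute, so the weight `lam j - c` splits into two square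
  -- roots and the difference is a square norm. This avoids orthogonalizing inside eigenspaces.
  have key : V *ᵥ a ⬝ᵥ M *ᵥ (V *ᵥ a) - c * (V *ᵥ a ⬝ᵥ V *ᵥ a)
      = (V *ᵥ fun i => √(lam i - c) * a i) ⬝ᵥ (V *ᵥ fun i => √(lam i - c) * a i) := by
    rw [hMV, mulVec_dotProduct_mulVec, mulVec_dotProduct_mulVec, mulVec_dotProduct_mulVec,
      Finset.mul_sum, ← Finset.sum_sub_distrib]
    refine Finset.sum_congr rfl fun i _ => ?_
    rw [Finset.mul_sum, ← Finset.sum_sub_distrib]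
    refine Finset.sum_congr rfl fun j _ => ?_
    by_cases hij : lam i = lam j
    · by_cases hai : a i = 0
      · simp [hai]
      · have hs : √(lam j - c) * √(lam j - c) = lam j - c :=
          Real.mul_self_sqrt (by linarith [ha i hai])
        rw [hij]
        linear_combination (-(a i * a j * (V.col i ⬝ᵥ V.col j))) * hs
    · rw [horth i j hij]; ring
  have := dotProduct_self_nonneg (V *ᵥ fun i => √(lam i - c) * a i)
  linarith

lemma dotProduct_mulVec_le_of_eigen {M : Matrix ι ι ℝ} (hM : Mᵀ = M) {lam : κ → ℝ}
    {V : Matrix ι κ ℝ} (hV : ∀ i, M *ᵥ V.col i = lam i • V.col i) {c : ℝ} {a : κ → ℝ}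
    (ha : ∀ i, a i ≠ 0 → lam i ≤ c) :
    V *ᵥ a ⬝ᵥ M *ᵥ (V *ᵥ a) ≤ c * (V *ᵥ a ⬝ᵥ V *ᵥ a) := by
  have := le_dotProduct_mulVec_of_eigen (M := -M) (by simp [hM]) (lam := fun i => -lam i)
    (V := V) (fun i => by rw [neg_mulVec, hV, neg_smul]) (c := -c) (a := a)
    (fun i hi => neg_le_neg (ha i hi))
  rw [neg_mulVec, dotProduct_neg] at this
  linarith

lemma dotProduct_self_pos {v : ι → ℝ} (hv : v ≠ 0) : 0 < v ⬝ᵥ v :=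
  lt_of_le_of_ne (dotProduct_self_nonneg v) fun h => hv (dotProduct_self_eq_zero.1 h.symm)

lemma IsOrderedEigensystem.le_eigenvalue {N : ℕ} {M : Matrix ι ι ℝ} {lam : Fin N → ℝ}
    {V : Matrix ι (Fin N) ℝ} (h : IsOrderedEigensystem M lam V) {c : ℝ}
    (hc : ∀ v, c * (v ⬝ᵥ v) ≤ v ⬝ᵥ M *ᵥ v) (i : Fin N) : c ≤ lam i := by
  have h1 := hc (V.col i)
  rw [h.eigen, dotProduct_smul, smul_eq_mul] at h1
  exact le_of_mul_le_mul_right h1 (dotProduct_self_pos (h.linearIndependent.ne_zero i))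

/-- If the quadratic form of `M` is at most `c` on an `l`-dimensional space, then the `l` smallest
eigenvalues are at most `c`. -/
lemma IsOrderedEigensystem.eigenvalue_le {l d : ℕ} {M : Matrix ι ι ℝ} (hM : Mᵀ = M)
    {lam : Fin (l + d) → ℝ} {V : Matrix ι (Fin (l + d)) ℝ} (h : IsOrderedEigensystem M lam V)
    {c : ℝ} {W : Matrix ι (Fin l) ℝ} (hW : ∀ y, W *ᵥ y = 0 → y = 0)
    (hc : ∀ y, W *ᵥ y ⬝ᵥ M *ᵥ (W *ᵥ y) ≤ c * (W *ᵥ y ⬝ᵥ W *ᵥ y)) (i : Fin l) :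
    lam (Fin.castAdd d i) ≤ c := by
  have hcard : Fintype.card (Fin (l + d)) = Module.finrank ℝ (ι → ℝ) := by
    rw [Module.finrank_fintype_fun_eq_card, h.card_eq, Fintype.card_fin]
  by_cases hne : l + d = 0
  · exact absurd i.2 (by omega)
  have : Nonempty (Fin (l + d)) := ⟨⟨0, by omega⟩⟩
  let b := basisOfLinearIndependentOfCardEqFinrank h.linearIndependent hcard
  have hb : ∀ v : ι → ℝ, V *ᵥ (b.repr v) = v := by
    intro v
    conv_rhs => rw [← b.sum_repr v]
    rw [mulVec_eq_sum_col]
    exact Finset.sum_congr rfl fun j _ => by simp [b]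
  -- Courant–Fischer: the first `i < l` eigencoordinates of `W *ᵥ y` can be made to vanish with `y ≠
  -- 0`; the Rayleigh quotient of that vector is then at least the eigenvalue of index `i`.
  let f : (Fin l → ℝ) →ₗ[ℝ] (Fin i → ℝ) :=
    { toFun := fun y s => b.repr (W *ᵥ y) ⟨s, by omega⟩
      map_add' := fun x y => by ext s; simp [mulVec_add]
      map_smul' := fun r y => by ext s; simp [mulVec_smul] }
  have hker : LinearMap.ker f ≠ ⊥ := LinearMap.ker_ne_bot_of_finrank_lt (by simp)
  obtain ⟨y, hy, hy0⟩ := (Submodule.ne_bot_iff _).1 hker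
  have h0 : ∀ s : Fin (l + d), (s : ℕ) < i → b.repr (W *ᵥ y) s = 0 := fun s hs =>
    congrFun (LinearMap.mem_ker.1 hy) ⟨s, hs⟩
  have h1 := le_dotProduct_mulVec_of_eigen hM h.eigen (c := lam (Fin.castAdd d i))
    (a := b.repr (W *ᵥ y)) (fun s hs => h.monotone (by
      by_contra hlt
      exact hs (h0 s (by simpa [Fin.lt_def] using hlt))))
  rw [hb] at h1
  exact le_of_mul_le_mul_right (h1.trans (hc y)) (dotProduct_self_pos fun h2 => hy0 (hW y h2))

lemma abs_dotProduct_mulVec_le {M : Matrix ι ι ℝ} {ε : ℝ} (hM : ∀ i j, |M i j| ≤ ε)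
    (v : ι → ℝ) : |v ⬝ᵥ M *ᵥ v| ≤ ε * Fintype.card ι * (v ⬝ᵥ v) := by
  have h1 : v ⬝ᵥ M *ᵥ v = ∑ i, ∑ j, v i * (M i j * v j) := by
    simp only [dotProduct, mulVec, Finset.mul_sum]
  have h2 : ε * Fintype.card ι * (v ⬝ᵥ v) = ∑ i, ∑ j, ε * ((v i * v i + v j * v j) / 2) := by
    simp only [← Finset.mul_sum, ← Finset.sum_div, Finset.sum_add_distrib, Finset.sum_const,
      Finset.card_univ, nsmul_eq_mul, dotProduct]
    have h3 : ∑ x, v x * ((Fintype.card ι : ℝ) * v x) = Fintype.card ι * ∑ x, v x * v x := by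
      rw [Finset.mul_sum]
      exact Finset.sum_congr rfl fun x _ => by ring
    rw [h3]
    ring
  rw [h1, h2]
  refine (Finset.abs_sum_le_sum_abs _ _).trans (Finset.sum_le_sum fun i _ => ?_)
  refine (Finset.abs_sum_le_sum_abs _ _).trans (Finset.sum_le_sum fun j _ => ?_)
  have h3 : |v i * (M i j * v j)| = |M i j| * (|v i| * |v j|) := by
    rw [abs_mul, abs_mul]; ring
  have h4 : |v i| * |v j| ≤ (v i * v i + v j * v j) / 2 := by
    rw [← abs_mul_abs_self (v i), ← abs_mul_abs_self (v j)]
    nlinarith [sq_nonneg (|v i| - |v j|)]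
  rw [h3]
  exact mul_le_mul (hM i j) h4 (by positivity) ((abs_nonneg _).trans (hM i j))

/-- Finitely many entries converge, so the forms converge uniformly on the unit sphere. With the
Rayleigh bounds this replaces eigenvalue perturbation theory. -/
lemma eventually_abs_dotProduct_mulVec_sub_le {α : Type*} {f : Filter α}
    {M : α → Matrix ι ι ℝ} {M₀ : Matrix ι ι ℝ} (h : Tendsto M f (𝓝 M₀)) {ε : ℝ} (hε : 0 < ε) :
    ∀ᶠ x in f, ∀ v : ι → ℝ, |v ⬝ᵥ M x *ᵥ v - v ⬝ᵥ M₀ *ᵥ v| ≤ ε * (v ⬝ᵥ v) := by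
  have hδ : 0 < ε / (Fintype.card ι + 1) := by positivity
  have h1 : ∀ᶠ x in f, ∀ i j, |M x i j - M₀ i j| ≤ ε / (Fintype.card ι + 1) := by
    rw [eventually_all]; intro i
    rw [eventually_all]; intro j
    have h2 : Tendsto (fun x => M x i j) f (𝓝 (M₀ i j)) :=
      (tendsto_pi_nhds.1 ((tendsto_pi_nhds.1 h) i)) j
    filter_upwards [Metric.tendsto_nhds.1 h2 _ hδ] with x hx
    exact (by simpa [Real.dist_eq] using hx : _ < _).le
  filter_upwards [h1] with x hx v
  have h3 := abs_dotProduct_mulVec_le (M := M x - M₀) hx v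
  rw [sub_mulVec, dotProduct_sub] at h3
  refine h3.trans (mul_le_mul_of_nonneg_right ?_ (dotProduct_self_nonneg v))
  rw [div_mul_eq_mul_div, div_le_iff₀ (by positivity)]
  nlinarith

end Rayleigh

/-! ### Kernels and domination of quadratic forms. -/

section Domination

variable {ι κ : Type*} [Fintype ι] [Fintype κ]

/-- If `A B = 0`, `B` is injective and the dimensions add up, then `ker A` is the range of `B`. -/
lemma exists_mulVec_eq_of_rank_add_card {ι κ τ : Type*} [Fintype ι] [Fintype τ] {A : Matrix κ ι ℝ} {B : Matrix ι τ ℝ}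
    (hB : ∀ y, B *ᵥ y = 0 → y = 0) (hAB : A * B = 0)
    (hcard : A.rank + Fintype.card τ = Fintype.card ι) {v : ι → ℝ} (hv : A *ᵥ v = 0) :
    ∃ y, B *ᵥ y = v := by
  have h1 := LinearMap.finrank_range_add_finrank_ker A.mulVecLin
  have h2 : Module.finrank ℝ (LinearMap.range B.mulVecLin) = Fintype.card τ := by
    rw [LinearMap.finrank_range_of_inj, Module.finrank_fintype_fun_eq_card]
    exact (injective_iff_map_eq_zero _).2 hB
  have h3 : LinearMap.range B.mulVecLin = LinearMap.ker A.mulVecLin := by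
    refine Submodule.eq_of_le_of_finrank_eq ?_ ?_
    · rintro _ ⟨y, rfl⟩
      simp [mulVec_mulVec, hAB]
    · rw [Matrix.rank] at hcard
      rw [Module.finrank_fintype_fun_eq_card] at h1
      omega
  have h4 : v ∈ LinearMap.range B.mulVecLin := by rw [h3]; exact hv
  exact h4

lemma exists_mulVec_dotProduct_le (M : Matrix κ ι ℝ) :
    ∃ C : ℝ, 0 ≤ C ∧ ∀ v, M *ᵥ v ⬝ᵥ M *ᵥ v ≤ C * (v ⬝ᵥ v) := by
  have h0 : ∀ i j, |(Mᵀ * M) i j| ≤ ∑ i, ∑ j, |(Mᵀ * M) i j| := fun i j =>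
    (Finset.single_le_sum (f := fun j => |(Mᵀ * M) i j|) (fun _ _ => abs_nonneg _)
      (Finset.mem_univ j)).trans
    (Finset.single_le_sum (f := fun i => ∑ j, |(Mᵀ * M) i j|)
      (fun _ _ => Finset.sum_nonneg fun _ _ => abs_nonneg _) (Finset.mem_univ i))
  refine ⟨(∑ i, ∑ j, |(Mᵀ * M) i j|) * Fintype.card ι, by positivity, fun v => ?_⟩
  have h1 := le_of_abs_le (abs_dotProduct_mulVec_le h0 v)
  rwa [← mulVec_mulVec, dotProduct_mulVec, vecMul_transpose] at h1

open scoped MatrixOrder in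
-- Write K = BᵀB. Then ker B ≤ ker K ≤ ker L, so L factors as g ∘ B with g linear, hence bounded,
-- while the form of K is the square norm of Bv.
lemma exists_mulVec_dotProduct_le_of_ker_le {K : Matrix ι ι ℝ} (hK : K.PosSemidef)
    {L : Matrix κ ι ℝ} (h : ∀ v, K *ᵥ v = 0 → L *ᵥ v = 0) :
    ∃ C : ℝ, 0 ≤ C ∧ ∀ v, L *ᵥ v ⬝ᵥ L *ᵥ v ≤ C * (v ⬝ᵥ K *ᵥ v) := by
  classical
  obtain ⟨B, rfl⟩ := CStarAlgebra.nonneg_iff_eq_star_mul_self.1 hK.nonneg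
  rw [star_eq_conjTranspose, conjTranspose_eq_transpose_of_trivial] at h ⊢
  let f := B.mulVecLin
  have hker : LinearMap.ker f ≤ LinearMap.ker L.mulVecLin := fun v hv => by
    have hv' : B *ᵥ v = 0 := hv
    exact h v (by rw [← mulVec_mulVec, hv', mulVec_zero])
  obtain ⟨g, hg⟩ := LinearMap.exists_extend
    (((LinearMap.ker f).liftQ L.mulVecLin hker) ∘ₗ f.quotKerEquivRange.symm.toLinearMap)
  have hgf : ∀ v, g (B *ᵥ v) = L *ᵥ v := fun v => by
    have := LinearMap.congr_fun hg ⟨f v, v, rfl⟩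
    simp only [LinearMap.comp_apply, Submodule.subtype_apply] at this
    change g (B *ᵥ v) = _ at this
    rw [this]
    have h2 : f.quotKerEquivRange.symm ⟨f v, v, rfl⟩ = (LinearMap.ker f).mkQ v := by
      rw [LinearEquiv.symm_apply_eq]; rfl
    rw [LinearEquiv.coe_coe, h2]
    rfl
  obtain ⟨C, hC0, hC⟩ := exists_mulVec_dotProduct_le (LinearMap.toMatrix' g)
  refine ⟨C, hC0, fun v => ?_⟩
  have := hC (B *ᵥ v)
  rw [LinearMap.toMatrix'_mulVec, hgf] at this
  rwa [← mulVec_mulVec, dotProduct_mulVec v, vecMul_transpose]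

end Domination

/-! ### Limits of the shift and of the Ritz spaces. -/

section Eigenspaces

/-- A shift between the extreme ones of the `l` smallest eigenvalues converges to the smallest
limit eigenvalue, when that one has multiplicity at least `l`. -/
lemma tendsto_shift {p l : ℕ} (hl : 0 < l)
    {G : ℕ → Matrix (Fin p ⊕ Fin l) (Fin p ⊕ Fin l) ℝ} {G₀ : Matrix (Fin p ⊕ Fin l) _ ℝ}
    {τ : ℝ} {mu : ℕ → ℝ} {W : Matrix (Fin p ⊕ Fin l) (Fin l) ℝ}
    (hsymm : ∀ m, (G m)ᵀ = G m)
    (hG : Tendsto (fun m : ℕ => (m : ℝ)⁻¹ • G m) atTop (𝓝 (G₀ + τ • 1)))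
    (hG₀ : ∀ v, 0 ≤ v ⬝ᵥ G₀ *ᵥ v) (hW : ∀ y, W *ᵥ y = 0 → y = 0)
    (hGW : ∀ y, G₀ *ᵥ (W *ᵥ y) = 0) (hmu : ∀ᶠ m in atTop, IsShift hl (G m) (mu m)) :
    Tendsto (fun m : ℕ => (m : ℝ)⁻¹ * mu m) atTop (𝓝 τ) := by
  rw [Metric.tendsto_nhds]
  intro ε hε
  filter_upwards [hmu, eventually_abs_dotProduct_mulVec_sub_le hG (half_pos hε),
    eventually_gt_atTop 0] with m ⟨lam, V, hV, h1, h2⟩ hm hm0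
  have hm0' : (0 : ℝ) < m := by exact_mod_cast hm0
  have hq : ∀ v, (m : ℝ) * (v ⬝ᵥ ((m : ℝ)⁻¹ • G m) *ᵥ v) = v ⬝ᵥ G m *ᵥ v := fun v => by
    rw [smul_mulVec, dotProduct_smul, smul_eq_mul, mul_inv_cancel_left₀ hm0'.ne']
  have hτ : ∀ v, v ⬝ᵥ (G₀ + τ • 1) *ᵥ v = v ⬝ᵥ G₀ *ᵥ v + τ * (v ⬝ᵥ v) := fun v => by
    rw [add_mulVec, smul_mulVec, one_mulVec, dotProduct_add, dotProduct_smul, smul_eq_mul]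
  have hlo : (m : ℝ) * (τ - ε / 2) ≤ lam (Fin.castAdd p ⟨0, hl⟩) :=
    hV.le_eigenvalue (fun v => by
      have h3 := (abs_le.1 (hm v)).1
      rw [hτ] at h3
      rw [← hq, mul_assoc]
      exact mul_le_mul_of_nonneg_left (by linarith [hG₀ v]) hm0'.le) _
  have hhi : lam (Fin.castAdd p ⟨l - 1, Nat.sub_lt hl Nat.one_pos⟩) ≤ m * (τ + ε / 2) :=
    hV.eigenvalue_le (hsymm m) hW (fun y => by
      have h3 := (abs_le.1 (hm (W *ᵥ y))).2
      rw [hτ, hGW, dotProduct_zero] at h3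
      rw [← hq, mul_assoc]
      exact mul_le_mul_of_nonneg_left (by linarith) hm0'.le) _
  have h5 : τ - ε / 2 ≤ (m : ℝ)⁻¹ * mu m := by
    rw [inv_mul_eq_div, le_div_iff₀ hm0']; linarith
  have h6 : (m : ℝ)⁻¹ * mu m ≤ τ + ε / 2 := by
    rw [inv_mul_eq_div, div_le_iff₀ hm0']; linarith
  rw [Real.dist_eq, abs_lt]
  constructor <;> linarith

lemma IsRitzCoordinates.mulVec_ne_zero {ι : Type*} [Fintype ι] {l d : ℕ} {F : Matrix ι ι ℝ}
    {P : Matrix ι (Fin (l + d)) ℝ} {Zt : Matrix (Fin (l + d)) (Fin l) ℝ}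
    (h : IsRitzCoordinates F P Zt) {y : Fin l → ℝ} (hy : Zt *ᵥ y = 0) : y = 0 := by
  obtain ⟨lam, V, hV, rfl⟩ := h
  have h1 := hV.linearIndependent.comp _ (Fin.castAdd_injective l d)
  rw [Fintype.linearIndependent_iff] at h1
  rw [mulVec_eq_sum_col] at hy
  exact funext (h1 y hy)

/-- On the span of Ritz vectors for the `l` smallest eigenvalues, the limit of the compressed
quadratic forms is small, when it vanishes on an `l`-dimensional space. -/
lemma eventually_ritz_le {ι : Type*} [Fintype ι] {l d : ℕ} {F : ℕ → Matrix ι ι ℝ}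
    {S : Matrix ι ι ℝ} {P : Matrix ι (Fin (l + d)) ℝ}
    {Zt : ℕ → Matrix (Fin (l + d)) (Fin l) ℝ} {W : Matrix (Fin (l + d)) (Fin l) ℝ}
    (hsymm : ∀ m, (F m)ᵀ = F m)
    (hF : Tendsto (fun m : ℕ => (m : ℝ)⁻¹ • F m) atTop (𝓝 S))
    (hW : ∀ y, W *ᵥ y = 0 → y = 0) (hSW : ∀ y, (Pᵀ * S * P) *ᵥ (W *ᵥ y) = 0)
    (hZ : ∀ᶠ m in atTop, IsRitzCoordinates (F m) P (Zt m)) {ε : ℝ} (hε : 0 < ε) :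
    ∀ᶠ m in atTop, ∀ y, Zt m *ᵥ y ⬝ᵥ (Pᵀ * S * P) *ᵥ (Zt m *ᵥ y)
      ≤ ε * (Zt m *ᵥ y ⬝ᵥ Zt m *ᵥ y) := by
  have hK : Tendsto (fun m : ℕ => (m : ℝ)⁻¹ • (Pᵀ * F m * P)) atTop (𝓝 (Pᵀ * S * P)) := by
    have hc : Continuous fun M : Matrix ι ι ℝ => Pᵀ * M * P := by fun_prop
    refine ((hc.tendsto S).comp hF).congr fun m => ?_
    simp
  filter_upwards [hZ, eventually_abs_dotProduct_mulVec_sub_le hK (half_pos hε),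
    eventually_gt_atTop 0] with m ⟨lam, V, hV, hZV⟩ hm hm0 y
  have hm0' : (0 : ℝ) < m := by exact_mod_cast hm0
  have hq : ∀ v, (m : ℝ) * (v ⬝ᵥ ((m : ℝ)⁻¹ • (Pᵀ * F m * P)) *ᵥ v)
      = v ⬝ᵥ (Pᵀ * F m * P) *ᵥ v := fun v => by
    rw [smul_mulVec, dotProduct_smul, smul_eq_mul, mul_inv_cancel_left₀ hm0'.ne']
  have hsymmK : (Pᵀ * F m * P)ᵀ = Pᵀ * F m * P := by
    simp [transpose_mul, hsymm, Matrix.mul_assoc]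
  have hlam : ∀ i : Fin l, lam (Fin.castAdd d i) ≤ m * (ε / 2) :=
    hV.eigenvalue_le hsymmK hW fun y => by
      have h3 := (abs_le.1 (hm (W *ᵥ y))).2
      rw [hSW, dotProduct_zero] at h3
      rw [← hq, mul_assoc]
      exact mul_le_mul_of_nonneg_left (by linarith) hm0'.le
  -- Padding by zero restricts the Rayleigh bound to eigenvalues already known to be at most `m * (ε
  -- / 2)`.
  have hz : Zt m *ᵥ y = V *ᵥ Fin.append y 0 := by
    rw [hZV, mulVec_eq_sum_col, mulVec_eq_sum_col, Fin.sum_univ_add]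
    simp
    rfl
  have h4 := dotProduct_mulVec_le_of_eigen hsymmK hV.eigen (c := m * (ε / 2))
    (a := Fin.append y 0) (fun i => by
      refine Fin.addCases (fun i _ => hlam i) (fun i hi => ?_) i
      simp at hi)
  rw [← hz, ← hq, mul_assoc] at h4
  have h5 := le_of_mul_le_mul_left h4 hm0'
  have h6 := (abs_le.1 (hm (Zt m *ᵥ y))).1
  linarith

/-- Deterministic error bound for `-(U Z) (L Z)⁻¹` as an approximation of `X`. -/
lemma isUnit_det_and_sq_error_le {ι κ : Type*} [Fintype ι] [Fintype κ] {l : ℕ}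
    {U : Matrix κ ι ℝ} {L : Matrix (Fin l) ι ℝ} {X : Matrix κ (Fin l) ℝ}
    {Z : Matrix ι (Fin l) ℝ} {δ : ℝ}
    (hZ : ∀ y, Z *ᵥ y = 0 → y = 0) (hUL : ∀ v, (U + X * L) *ᵥ v = 0 → L *ᵥ v = 0 → v = 0)
    (hδ : ∀ y, (U + X * L) *ᵥ (Z *ᵥ y) ⬝ᵥ (U + X * L) *ᵥ (Z *ᵥ y)
      ≤ δ * (L *ᵥ (Z *ᵥ y) ⬝ᵥ L *ᵥ (Z *ᵥ y))) :
    IsUnit (L * Z).det ∧ ∀ s t, ((-(U * Z * (L * Z)⁻¹)) s t - X s t) ^ 2 ≤ δ := by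
  have hdet : IsUnit (L * Z).det := by
    rw [isUnit_iff_ne_zero]
    intro h0
    obtain ⟨y, hy0, hy⟩ := Matrix.exists_mulVec_eq_zero_iff.2 h0
    rw [← mulVec_mulVec] at hy
    have h1 := hδ y
    rw [hy, dotProduct_zero, mul_zero] at h1
    exact hy0 (hZ y (hUL _ (dotProduct_self_eq_zero.1
      (le_antisymm h1 (dotProduct_self_nonneg _))) hy))
  refine ⟨hdet, fun s t => ?_⟩
  have hE : -(U * Z * (L * Z)⁻¹) - X = -((U + X * L) * Z * (L * Z)⁻¹) := by
    rw [Matrix.add_mul, Matrix.add_mul, Matrix.mul_assoc X L Z, Matrix.mul_assoc X (L * Z),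
      mul_nonsing_inv _ hdet, Matrix.mul_one]
    abel
  -- For this vector `L *ᵥ (Z *ᵥ y)` is the t-th unit vector, so the hypothesis bounds the t-th
  -- column of the error by δ in square norm.
  have h1 := hδ ((L * Z)⁻¹.col t)
  have h2 : L *ᵥ (Z *ᵥ (L * Z)⁻¹.col t) = Pi.single t 1 := by
    rw [mulVec_mulVec, ← mulVec_single_one, mulVec_mulVec, mul_nonsing_inv _ hdet, one_mulVec]
  have h3 : (U + X * L) *ᵥ (Z *ᵥ (L * Z)⁻¹.col t)
      = fun s => ((U + X * L) * Z * (L * Z)⁻¹) s t := by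
    rw [mulVec_mulVec, ← mulVec_single_one, mulVec_mulVec, mulVec_single_one]
    rfl
  rw [h2, h3, single_one_dotProduct, Pi.single_eq_same, mul_one] at h1
  have h4 : (-(U * Z * (L * Z)⁻¹)) s t - X s t = -((U + X * L) * Z * (L * Z)⁻¹) s t := by
    rw [← Matrix.sub_apply, hE, neg_apply]
  rw [h4, neg_sq, sq]
  exact (Finset.single_le_sum (f := fun s => ((U + X * L) * Z * (L * Z)⁻¹) s t *
    ((U + X * L) * Z * (L * Z)⁻¹) s t) (fun _ _ => mul_self_nonneg _)
    (Finset.mem_univ s)).trans h1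

end Eigenspaces

/-! ### A strong law for weighted sums. -/

section StrongLaw

lemma tendsto_sq_sqrt_div : Tendsto (fun n : ℕ => ((n.sqrt ^ 2 : ℕ) : ℝ) / n) atTop (𝓝 1) := by
  have hsqrt : Tendsto Nat.sqrt atTop atTop :=
    tendsto_atTop.2 fun b => (eventually_ge_atTop (b * b)).mono fun n hn => Nat.le_sqrt.2 hn
  have h1 : Tendsto (fun n : ℕ => 1 - 2 / (n.sqrt : ℝ)) atTop (𝓝 1) := by
    simpa using (tendsto_const_nhds (x := (1 : ℝ))).sub ((tendsto_const_nhds (x := (2 : ℝ))).div_atTop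
      ((tendsto_natCast_atTop_atTop (R := ℝ)).comp hsqrt))
  refine tendsto_of_tendsto_of_tendsto_of_le_of_le' h1 tendsto_const_nhds ?_ ?_
  · filter_upwards [eventually_ge_atTop 1] with n hn
    have hk : 1 ≤ n.sqrt := Nat.le_sqrt.2 (by omega)
    have h2 : n ≤ n.sqrt * n.sqrt + n.sqrt + n.sqrt := Nat.sqrt_le_add n
    have h3 : n.sqrt * n.sqrt ≤ n := Nat.sqrt_le n
    generalize n.sqrt = k at *
    have hk' : (1 : ℝ) ≤ k := by exact_mod_cast hk
    have hn' : (0 : ℝ) < n := by exact_mod_cast hn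
    have h2' : (n : ℝ) ≤ k * k + k + k := by exact_mod_cast h2
    have h3' : (k : ℝ) * k ≤ n := by exact_mod_cast h3
    rw [le_div_iff₀ hn']
    push_cast
    have h4 : 2 * (k : ℝ) ≤ 2 / k * n := by
      rw [div_mul_eq_mul_div, le_div_iff₀ (by linarith)]; linarith
    nlinarith
  · filter_upwards [eventually_ge_atTop 1] with n hn
    have hn' : (0 : ℝ) < n := by exact_mod_cast hn
    rw [div_le_one hn']
    exact_mod_cast Nat.sqrt_le' n

/-- Averages of products converge to zero along all `n` once they do so along the squares,
if both factors have convergent mean squares. -/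
lemma tendsto_avg_mul_of_squares {c x : ℕ → ℝ} {a b : ℝ}
    (hc : Tendsto (fun n : ℕ => (∑ i ∈ Finset.range n, c i ^ 2) / n) atTop (𝓝 a))
    (hx : Tendsto (fun n : ℕ => (∑ i ∈ Finset.range n, x i ^ 2) / n) atTop (𝓝 b))
    (h : Tendsto (fun k : ℕ => (∑ i ∈ Finset.range (k ^ 2), c i * x i) / ((k ^ 2 : ℕ) : ℝ))
      atTop (𝓝 0)) :
    Tendsto (fun n : ℕ => (∑ i ∈ Finset.range n, c i * x i) / n) atTop (𝓝 0) := by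
  have hsqrt : Tendsto Nat.sqrt atTop atTop :=
    tendsto_atTop.2 fun b => (eventually_ge_atTop (b * b)).mono fun n hn => Nat.le_sqrt.2 hn
  have hsq : Tendsto (fun n : ℕ => n.sqrt ^ 2) atTop atTop :=
    (tendsto_pow_atTop two_ne_zero).comp hsqrt
  have hpos : ∀ᶠ n : ℕ in atTop, (0 : ℝ) < n ∧ (0 : ℝ) < (n.sqrt ^ 2 : ℕ) := by
    filter_upwards [eventually_gt_atTop 0, hsq.eventually_gt_atTop 0] with n h1 h2
    exact ⟨by exact_mod_cast h1, by exact_mod_cast h2⟩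
  -- If averages converge, the block from the last square up to `n` contributes nothing in the
  -- limit: it is a difference of two averages with the same limit.
  have hgap : ∀ {f : ℕ → ℝ} {r : ℝ},
      Tendsto (fun n : ℕ => (∑ i ∈ Finset.range n, f i) / n) atTop (𝓝 r) →
      Tendsto (fun n : ℕ => (∑ i ∈ Finset.Ico (n.sqrt ^ 2) n, f i) / n) atTop (𝓝 0) := by
    intro f r hf
    have h1 := hf.sub ((hf.comp hsq).mul tendsto_sq_sqrt_div)
    rw [mul_one, sub_self] at h1
    refine h1.congr' ?_
    filter_upwards [hpos] with n hn
    rw [Finset.sum_Ico_eq_sub _ (Nat.sqrt_le' n), sub_div, Function.comp_apply,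
      div_mul_div_cancel₀ hn.2.ne']
  -- Cauchy–Schwarz on the block; both mean squares over it vanish by `hgap`.
  have hgapc : Tendsto (fun n : ℕ => (∑ i ∈ Finset.Ico (n.sqrt ^ 2) n, c i * x i) / n)
      atTop (𝓝 0) := by
    have h1 := ((hgap hc).mul (hgap hx)).sqrt
    rw [mul_zero, Real.sqrt_zero] at h1
    refine squeeze_zero_norm' ?_ h1
    filter_upwards [hpos] with n hn
    rw [Real.norm_eq_abs]
    refine Real.abs_le_sqrt ?_
    rw [div_pow, div_mul_div_comm, ← sq (n : ℝ)]
    exact div_le_div_of_nonneg_right (Finset.sum_mul_sq_le_sq_mul_sq _ _ _) (by positivity)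
  have h2 := ((h.comp hsqrt).mul tendsto_sq_sqrt_div).add hgapc
  rw [zero_mul, zero_add] at h2
  refine h2.congr' ?_
  filter_upwards [hpos] with n hn
  rw [Finset.sum_Ico_eq_sub _ (Nat.sqrt_le' n), Function.comp_apply,
    div_mul_div_cancel₀ hn.2.ne', ← add_div, add_sub_cancel]

variable {Ω : Type*} [MeasurableSpace Ω] {Pr : Measure Ω}

/-- By Tonelli the sum of the `g k` has finite integral, so it is finite almost everywhere and its
terms tend to zero. -/
lemma ae_tendsto_zero_of_summable_integral {g : ℕ → Ω → ℝ} (hg : ∀ k, Integrable (g k) Pr)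
    (hg0 : ∀ k ω, 0 ≤ g k ω) (hs : Summable fun k => ∫ ω, g k ω ∂Pr) :
    ∀ᵐ ω ∂Pr, Tendsto (fun k => g k ω) atTop (𝓝 0) := by
  have h1 : ∫⁻ ω, ∑' k, ENNReal.ofReal (g k ω) ∂Pr ≠ ⊤ := by
    rw [lintegral_tsum fun k => (hg k).aemeasurable.ennreal_ofReal]
    have h2 : ∀ k, ∫⁻ ω, ENNReal.ofReal (g k ω) ∂Pr = ENNReal.ofReal (∫ ω, g k ω ∂Pr) := fun k =>
      (ofReal_integral_eq_lintegral_ofReal (hg k) (ae_of_all _ (hg0 k))).symm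
    simp_rw [h2]
    rw [← ENNReal.ofReal_tsum_of_nonneg (fun k => integral_nonneg (hg0 k)) hs]
    exact ENNReal.ofReal_ne_top
  have h3 := ae_lt_top' (AEMeasurable.tsum fun k => (hg k).aemeasurable.ennreal_ofReal) h1
  filter_upwards [h3] with ω hω
  have h4 := (ENNReal.tendsto_toReal ENNReal.zero_ne_top).comp
    (ENNReal.tendsto_atTop_zero_of_tsum_ne_top hω.ne)
  refine h4.congr fun k => ?_
  simp [ENNReal.toReal_ofReal (hg0 k ω)]

/-- Strong law for weighted sums of centred i.i.d. square-integrable variables whose weights have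
convergent mean squares. -/
lemma ae_tendsto_avg_weighted [IsProbabilityMeasure Pr] {X : ℕ → Ω → ℝ}
    (hL2 : ∀ i, MemLp (X i) 2 Pr) (hindep : Pairwise fun i j => IndepFun (X i) (X j) Pr)
    (hident : ∀ i, IdentDistrib (X i) (X 0) Pr Pr) (hmean : ∀ i, ∫ ω, X i ω ∂Pr = 0)
    {c : ℕ → ℝ} {a : ℝ}
    (hc : Tendsto (fun n : ℕ => (∑ i ∈ Finset.range n, c i ^ 2) / n) atTop (𝓝 a)) :
    ∀ᵐ ω ∂Pr, Tendsto (fun n : ℕ => (∑ i ∈ Finset.range n, c i * X i ω) / n) atTop (𝓝 0) := by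
  have hsq := strong_law_ae_real (fun i ω => X i ω ^ 2) (hL2 0).integrable_sq
    (fun i j hij => (hindep hij).comp (measurable_id.pow_const 2) (measurable_id.pow_const 2))
    (fun i => (hident i).comp (measurable_id.pow_const 2))
  obtain ⟨K, hK⟩ := hc.bddAbove_range
  have hK' : ∀ n : ℕ, ∑ i ∈ Finset.range n, c i ^ 2 ≤ K * n := fun n => by
    rcases n.eq_zero_or_pos with rfl | hn
    · simp
    · exact (div_le_iff₀ (by exact_mod_cast hn)).1 (hK ⟨n, rfl⟩)
  let T : ℕ → Ω → ℝ := fun n ω => ∑ i ∈ Finset.range n, c i * X i ω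
  have hcX : ∀ i, MemLp (fun ω => c i * X i ω) 2 Pr := fun i => (hL2 i).const_mul (c i)
  have hT : ∀ n, MemLp (T n) 2 Pr := fun n => memLp_finsetSum _ fun i _ => hcX i
  have hT0 : ∀ n, ∫ ω, T n ω ∂Pr = 0 := fun n => by
    rw [integral_finsetSum _ fun i _ => (hcX i).integrable one_le_two]
    exact Finset.sum_eq_zero fun i _ => by rw [integral_const_mul, hmean, mul_zero]
  have hT2 : ∀ n, ∫ ω, T n ω ^ 2 ∂Pr = (∑ i ∈ Finset.range n, c i ^ 2) * variance (X 0) Pr := by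
    intro n
    have h1 : variance (T n) Pr = ∫ ω, T n ω ^ 2 ∂Pr :=
      variance_of_integral_eq_zero (hT n).aemeasurable (hT0 n)
    have h2 : T n = ∑ i ∈ Finset.range n, fun ω => c i * X i ω := by
      ext ω; simp [T]
    rw [← h1, h2, IndepFun.variance_sum (fun i _ => hcX i) (fun i _ j _ hij =>
      (hindep hij).comp (measurable_const_mul (c i)) (measurable_const_mul (c j))),
      Finset.sum_mul]
    exact Finset.sum_congr rfl fun i _ => by
      rw [variance_const_mul, (hident i).variance_eq]
  -- The mean square of `T n / n` is only O(1/n), which is not summable; along `n = k ^ 2` it is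
  -- O(1/k²).
  have hsum : Summable fun k : ℕ => ∫ ω, (T (k ^ 2) ω / ((k ^ 2 : ℕ) : ℝ)) ^ 2 ∂Pr := by
    refine Summable.of_nonneg_of_le (fun k => integral_nonneg fun ω => sq_nonneg _) (fun k => ?_)
      ((Real.summable_one_div_nat_pow.2 one_lt_two).mul_left (K * variance (X 0) Pr))
    simp_rw [div_pow]
    rw [integral_div, hT2]
    rcases k.eq_zero_or_pos with rfl | hk
    · simp
    · have hk' : (0 : ℝ) < k := by exact_mod_cast hk
      rw [div_le_iff₀ (by positivity)]
      have h3 := mul_le_mul_of_nonneg_right (hK' (k ^ 2)) (variance_nonneg (X 0) Pr)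
      refine h3.trans (le_of_eq ?_)
      push_cast
      field_simp
  have hlim := ae_tendsto_zero_of_summable_integral
    (fun k => by
      simp_rw [div_pow]
      exact (hT _).integrable_sq.div_const _) (fun k ω => sq_nonneg _) hsum
  filter_upwards [hsq, hlim] with ω h1 h2
  refine tendsto_avg_mul_of_squares hc h1 ?_
  have h3 := h2.sqrt
  rw [Real.sqrt_zero] at h3
  simp_rw [Real.sqrt_sq_eq_abs] at h3
  exact (tendsto_zero_iff_abs_tendsto_zero _).2 h3

end StrongLaw

/-! ### Limit of the observed Gram matrix. -/

section Gram

/-- The lower block has m - j rows but is normalized by m; since (m - j)/m → 1 the limit is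
unaffected. -/
lemma tendsto_inv_mul_sub {f : ℕ → ℝ} {a : ℝ} (j : ℕ)
    (h : Tendsto (fun n : ℕ => f n / n) atTop (𝓝 a)) :
    Tendsto (fun m : ℕ => (m : ℝ)⁻¹ * f (m - j)) atTop (𝓝 a) := by
  rw [← tendsto_add_atTop_iff_nat j]
  have h1 : Tendsto (fun n : ℕ => (n : ℝ) / ((n + j : ℕ) : ℝ)) atTop (𝓝 1) := by
    simpa using tendsto_natCast_div_add_atTop (j : ℝ)
  have h2 := h.mul h1
  rw [mul_one] at h2
  refine h2.congr' ?_
  filter_upwards [eventually_gt_atTop 0] with n hn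
  have hn' : (n : ℝ) ≠ 0 := by exact_mod_cast hn.ne'
  rw [div_mul_div_cancel₀ hn', Nat.add_sub_cancel, inv_mul_eq_div]

lemma tendsto_div_of_inv_mul_sub {f : ℕ → ℝ} {a : ℝ} (j : ℕ)
    (h : Tendsto (fun m : ℕ => (m : ℝ)⁻¹ * f (m - j)) atTop (𝓝 a)) :
    Tendsto (fun n : ℕ => f n / n) atTop (𝓝 a) := by
  rw [← tendsto_add_atTop_iff_nat j] at h
  have h1 : Tendsto (fun n : ℕ => (n : ℝ) / ((n + j : ℕ) : ℝ)) atTop (𝓝 1) := by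
    simpa using tendsto_natCast_div_add_atTop (j : ℝ)
  have h2 := h.div h1 one_ne_zero
  rw [div_one] at h2
  refine h2.congr' ?_
  filter_upwards [eventually_gt_atTop 0] with n hn
  have hn' : (n : ℝ) ≠ 0 := by exact_mod_cast hn.ne'
  have hn2 : ((n + j : ℕ) : ℝ) ≠ 0 := by positivity
  simp only [Pi.div_apply, Nat.add_sub_cancel]
  field_simp

variable {Ω : Type*} [MeasurableSpace Ω] {Pr : Measure Ω} [IsProbabilityMeasure Pr]
  {κ q : Type*} [Fintype q] [DecidableEq q] {e : ℕ → Ω → q → ℝ} {σ : ℝ}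

lemma NoiseAssumption.ae_tendsto_weighted (hE : NoiseAssumption Pr e σ) (t : κ ⊕ q) {c : ℕ → ℝ}
    {a : ℝ} (hc : Tendsto (fun n : ℕ => (∑ i ∈ Finset.range n, c i ^ 2) / n) atTop (𝓝 a)) :
    ∀ᵐ ω ∂Pr, Tendsto (fun n : ℕ =>
      (∑ i ∈ Finset.range n, c i * Sum.elim (0 : κ → ℝ) (e i ω) t) / n) atTop (𝓝 0) := by
  rcases t with t | t
  · simp
  · exact ae_tendsto_avg_weighted (fun i => hE.memLp i t)
      (fun i j hij => (hE.indep.indepFun hij).comp (measurable_pi_apply t) (measurable_pi_apply t))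
      (fun i => (hE.identDistrib i).comp (measurable_pi_apply t)) (fun i => hE.mean i t) hc

lemma NoiseAssumption.ae_tendsto_products (hE : NoiseAssumption Pr e σ) (s t : κ ⊕ q) :
    ∀ᵐ ω ∂Pr, Tendsto (fun n : ℕ => (∑ i ∈ Finset.range n,
      Sum.elim (0 : κ → ℝ) (e i ω) s * Sum.elim (0 : κ → ℝ) (e i ω) t) / n) atTop
      (𝓝 ((σ ^ 2 • fromBlocks (0 : Matrix κ κ ℝ) 0 0 (1 : Matrix q q ℝ)) s t)) := by
  rcases s with s | s
  · rcases t with t | t <;> simp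
  rcases t with t | t
  · simp
  have hmeas : Measurable fun v : q → ℝ => v s * v t := by fun_prop
  have h1 := strong_law_ae_real (fun i ω => e i ω s * e i ω t)
    ((hE.memLp 0 s).integrable_mul (hE.memLp 0 t))
    (fun i j hij => (hE.indep.indepFun hij).comp hmeas hmeas)
    (fun i => (hE.identDistrib i).comp hmeas)
  have h2 := hE.cov 0 s t
  rw [covariance_eq_sub (hE.memLp 0 s) (hE.memLp 0 t), hE.mean, zero_mul, sub_zero] at h2
  have h3 : ∫ ω, e 0 ω s * e 0 ω t ∂Pr = (σ ^ 2 • (1 : Matrix q q ℝ)) s t := h2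
  rw [h3] at h1
  exact h1

/-- The normalized Gram matrix of the observed block converges to that of the exact block plus the
covariance of the noise. -/
lemma NoiseAssumption.ae_tendsto_gram [Fintype κ] (hE : NoiseAssumption Pr e σ) {j : ℕ} {C : ℕ → κ ⊕ q → ℝ}
    {S : Matrix (κ ⊕ q) (κ ⊕ q) ℝ}
    (hS : Tendsto (fun m : ℕ => (m : ℝ)⁻¹ • ((lowerRows j m C)ᵀ * lowerRows j m C)) atTop (𝓝 S)) :
    ∀ᵐ ω ∂Pr, Tendsto (fun m : ℕ => (m : ℝ)⁻¹ •
      ((observedLower j m C fun i => e i ω)ᵀ * observedLower j m C fun i => e i ω)) atTop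
      (𝓝 (S + σ ^ 2 • fromBlocks (0 : Matrix κ κ ℝ) 0 0 (1 : Matrix q q ℝ))) := by
  have hSst : ∀ s t, Tendsto (fun n : ℕ =>
      (∑ i ∈ Finset.range n, C (j + i) s * C (j + i) t) / n) atTop (𝓝 (S s t)) := by
    intro s t
    refine tendsto_div_of_inv_mul_sub (f := fun n => ∑ i ∈ Finset.range n,
      C (j + i) s * C (j + i) t) j ?_
    refine (tendsto_pi_nhds.1 (tendsto_pi_nhds.1 hS s) t).congr fun m => ?_
    simp only [Matrix.smul_apply, Matrix.mul_apply, transpose_apply, smul_eq_mul, lowerRows,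
      of_apply]
    rw [Fin.sum_univ_eq_sum_range fun i => C (j + i) s * C (j + i) t]
  -- The diagonal of S provides the mean squares of the weights in the strong law for the cross
  -- terms, so the exact data need not be bounded.
  have hsq : ∀ s, Tendsto (fun n : ℕ =>
      (∑ i ∈ Finset.range n, C (j + i) s ^ 2) / n) atTop (𝓝 (S s s)) := fun s => by
    simpa only [sq] using hSst s s
  have h1 := ae_all_iff.2 fun s => ae_all_iff.2 fun t =>
    hE.ae_tendsto_weighted (κ := κ) t (hsq s)
  have h2 := ae_all_iff.2 fun s => ae_all_iff.2 fun t => hE.ae_tendsto_products (κ := κ) s t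
  filter_upwards [h1, h2] with ω hω1 hω2
  refine tendsto_pi_nhds.2 fun s => tendsto_pi_nhds.2 fun t => ?_
  have h3 := tendsto_inv_mul_sub (f := fun n => ∑ i ∈ Finset.range n,
    (C (j + i) s + Sum.elim (0 : κ → ℝ) (e i ω) s) * (C (j + i) t + Sum.elim (0 : κ → ℝ) (e i ω) t))
    (a := (S + σ ^ 2 • fromBlocks (0 : Matrix κ κ ℝ) 0 0 (1 : Matrix q q ℝ)) s t) j (by
      have h4 := (((hSst s t).add (hω1 s t)).add (hω1 t s)).add (hω2 s t)
      rw [add_zero, add_zero] at h4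
      refine h4.congr fun n => ?_
      rw [← add_div, ← add_div, ← add_div, ← Finset.sum_add_distrib, ← Finset.sum_add_distrib,
        ← Finset.sum_add_distrib]
      congr 1
      exact Finset.sum_congr rfl fun i _ => by ring)
  refine h3.congr fun m => ?_
  have h5 : ∀ (i : Fin (m - j)) s, observedLower j m C (fun i => e i ω) i s
      = C (j + i) s + Sum.elim (0 : κ → ℝ) (e i ω) s := by
    intro i s
    rcases s with s | s <;> simp [observedLower, lowerRows]
  simp only [Matrix.smul_apply, Matrix.mul_apply, transpose_apply, smul_eq_mul, h5]
  rw [← Fin.sum_univ_eq_sum_range fun i => (C (j + i) s + Sum.elim (0 : κ → ℝ) (e i ω) s) *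
    (C (j + i) t + Sum.elim (0 : κ → ℝ) (e i ω) t)]

end Gram

/-! ### Algebra and limits of the matrices G and F. -/

section Gram

lemma tendsto_matrix_mul {α m n r : Type*} [Fintype n] {f : Filter α} {M : α → Matrix m n ℝ}
    {N : α → Matrix n r ℝ} {M₀ : Matrix m n ℝ} {N₀ : Matrix n r ℝ} (hM : Tendsto M f (𝓝 M₀))
    (hN : Tendsto N f (𝓝 N₀)) : Tendsto (fun x => M x * N x) f (𝓝 (M₀ * N₀)) := by
  have hc : Continuous fun x : Matrix m n ℝ × Matrix n r ℝ => x.1 * x.2 :=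
    continuous_fst.matrix_mul continuous_snd
  exact (hc.tendsto (M₀, N₀)).comp (hM.prodMk_nhds hN)

variable {r κ q : Type*} [Fintype r]

lemma toBlocks₁₁_transpose_mul_self (C : Matrix r (κ ⊕ q) ℝ) :
    (Cᵀ * C).toBlocks₁₁ = C.toCols₁ᵀ * C.toCols₁ := rfl

lemma matF_eq [DecidableEq q] (C : Matrix r (κ ⊕ q) ℝ) (mu : ℝ) :
    matF C mu = Cᵀ * C - mu • fromBlocks 0 0 0 1 := by
  ext s t
  rcases s with s | s <;> rcases t with t | t <;>
    simp [matF, Matrix.mul_apply, toCols₁, toCols₂]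

lemma transpose_matF [DecidableEq q] (C : Matrix r (κ ⊕ q) ℝ) (mu : ℝ) : (matF C mu)ᵀ = matF C mu := by
  rw [matF_eq, transpose_sub, transpose_mul, transpose_transpose, transpose_smul,
    fromBlocks_transpose]
  simp

lemma matG_eq [Fintype κ] [DecidableEq κ] (C : Matrix r (κ ⊕ q) ℝ) :
    matG C = (Cᵀ * C).toBlocks₂₂
      - (Cᵀ * C).toBlocks₂₁ * (Cᵀ * C).toBlocks₁₁⁻¹ * (Cᵀ * C).toBlocks₁₂ := by
  rw [toBlocks₁₁_transpose_mul_self, matG, Matrix.mul_assoc _ C.toCols₁ᵀ]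
  rfl

lemma transpose_matG [Fintype κ] [DecidableEq κ] (C : Matrix r (κ ⊕ q) ℝ) : (matG C)ᵀ = matG C := by
  simp only [matG, transpose_sub, transpose_mul, transpose_transpose, transpose_nonsing_inv,
    Matrix.mul_assoc]

/-- The Schur complement is homogeneous of degree one in the Gram matrix, and continuous where the
leading block is invertible. -/
lemma tendsto_matG [Fintype κ] [DecidableEq κ] {ρ : ℕ → Type*} [∀ m, Fintype (ρ m)]
    {C : ∀ m, Matrix (ρ m) (κ ⊕ q) ℝ} {H : Matrix (κ ⊕ q) (κ ⊕ q) ℝ}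
    (hC : Tendsto (fun m : ℕ => (m : ℝ)⁻¹ • ((C m)ᵀ * C m)) atTop (𝓝 H))
    (hH : IsUnit H.toBlocks₁₁.det) :
    Tendsto (fun m : ℕ => (m : ℝ)⁻¹ • matG (C m)) atTop
      (𝓝 (H.toBlocks₂₂ - H.toBlocks₂₁ * H.toBlocks₁₁⁻¹ * H.toBlocks₁₂)) := by
  have h11 : Continuous fun M : Matrix (κ ⊕ q) (κ ⊕ q) ℝ => M.toBlocks₁₁ :=
    continuous_id.matrix_submatrix _ _
  have h12 : Continuous fun M : Matrix (κ ⊕ q) (κ ⊕ q) ℝ => M.toBlocks₁₂ :=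
    continuous_id.matrix_submatrix _ _
  have h21 : Continuous fun M : Matrix (κ ⊕ q) (κ ⊕ q) ℝ => M.toBlocks₂₁ :=
    continuous_id.matrix_submatrix _ _
  have h22 : Continuous fun M : Matrix (κ ⊕ q) (κ ⊕ q) ℝ => M.toBlocks₂₂ :=
    continuous_id.matrix_submatrix _ _
  have hinv : Tendsto (fun m : ℕ => ((m : ℝ)⁻¹ • ((C m)ᵀ * C m)).toBlocks₁₁⁻¹) atTop
      (𝓝 H.toBlocks₁₁⁻¹) := by
    refine Tendsto.comp (continuousAt_matrix_inv _ ?_) ((h11.tendsto H).comp hC)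
    rw [Ring.inverse_eq_inv']
    exact continuousAt_inv₀ hH.ne_zero
  have hdet := ((h11.matrix_det.tendsto H).comp hC).eventually_ne hH.ne_zero
  refine (((h22.tendsto H).comp hC).sub (tendsto_matrix_mul
    (tendsto_matrix_mul ((h21.tendsto H).comp hC) hinv) ((h12.tendsto H).comp hC))).congr' ?_
  filter_upwards [hdet, eventually_gt_atTop 0] with m hm hm0
  have hm0' : (m : ℝ) ≠ 0 := by exact_mod_cast hm0.ne'
  simp only [Function.comp_apply] at hm ⊢
  rw [matG_eq]
  have hb : ((m : ℝ)⁻¹ • ((C m)ᵀ * C m)).toBlocks₁₁ = (m : ℝ)⁻¹ • ((C m)ᵀ * C m).toBlocks₁₁ := rfl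
  have hi : ((m : ℝ)⁻¹ • ((C m)ᵀ * C m).toBlocks₁₁)⁻¹
      = (m : ℝ) • ((C m)ᵀ * C m).toBlocks₁₁⁻¹ := by
    rw [hb, det_smul] at hm
    refine inv_eq_left_inv ?_
    rw [smul_mul, Matrix.mul_smul, smul_smul, mul_inv_cancel₀ hm0', one_smul,
      nonsing_inv_mul _ (isUnit_iff_ne_zero.2 (right_ne_zero_of_mul hm))]
  rw [hb, hi]
  change (m : ℝ)⁻¹ • ((C m)ᵀ * C m).toBlocks₂₂ - (m : ℝ)⁻¹ • ((C m)ᵀ * C m).toBlocks₂₁ *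
    (m : ℝ) • ((C m)ᵀ * C m).toBlocks₁₁⁻¹ * (m : ℝ)⁻¹ • ((C m)ᵀ * C m).toBlocks₁₂ = _
  rw [smul_sub, Matrix.mul_smul, smul_mul, Matrix.mul_smul, smul_smul, inv_mul_cancel₀ hm0',
    one_smul]

lemma posSemidef_of_tendsto_gram {ρ : ℕ → Type*} [∀ m, Fintype (ρ m)]
    {C : ∀ m, Matrix (ρ m) r ℝ} {S : Matrix r r ℝ}
    (hS : Tendsto (fun m : ℕ => (m : ℝ)⁻¹ • ((C m)ᵀ * C m)) atTop (𝓝 S)) : S.PosSemidef := by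
  have hm : ∀ m : ℕ, ((m : ℝ)⁻¹ • ((C m)ᵀ * C m)).PosSemidef := fun m => by
    rw [← conjTranspose_eq_transpose_of_trivial]
    exact (posSemidef_conjTranspose_mul_self (C m)).smul (by positivity)
  refine PosSemidef.of_dotProduct_mulVec_nonneg ?_ fun v => ?_
  · refine tendsto_nhds_unique (f := fun m : ℕ => ((m : ℝ)⁻¹ • ((C m)ᵀ * C m))ᴴ) ?_
      (hS.congr fun m => (hm m).isHermitian.symm)
    exact ((continuous_id.matrix_conjTranspose).tendsto S).comp hS
  · have hc : Continuous fun M : Matrix r r ℝ => star v ⬝ᵥ M *ᵥ v := by fun_prop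
    exact ge_of_tendsto' ((hc.tendsto S).comp hS) fun m => (hm m).dotProduct_mulVec_nonneg v

end Gram

/-! ### The regression model and the deterministic error estimate. -/

section Model

variable {k p l : ℕ}

/-- The block column `[X; -I]`, annihilated by the exact rows `[A B]` when `A X = B`. -/
def solutionKernel (X : Matrix (Fin k ⊕ Fin p) (Fin l) ℝ) :
    Matrix (Fin k ⊕ (Fin p ⊕ Fin l)) (Fin l) ℝ :=
  fromRows (X.submatrix Sum.inl id) (fromRows (X.submatrix Sum.inr id) (-1))

lemma rowsC_vecMul_solutionKernel {X : Matrix (Fin k ⊕ Fin p) (Fin l) ℝ}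
    {A : ℕ → Fin k ⊕ Fin p → ℝ} {B : ℕ → Fin l → ℝ} (h : ∀ i, A i ᵥ* X = B i) (i : ℕ) :
    rowsC A B i ᵥ* solutionKernel X = 0 := by
  ext t
  have h1 := congrFun (h i) t
  have h2 : ∑ u, B i u * (-1 : Matrix (Fin l) (Fin l) ℝ) u t = -B i t := by
    simp [one_apply]
  simp only [vecMul, dotProduct, Fintype.sum_sum_type] at h1
  simp only [vecMul, dotProduct, Fintype.sum_sum_type, rowsC, solutionKernel, Sum.elim_inl,
    Sum.elim_inr, fromRows_apply_inl, fromRows_apply_inr, submatrix_apply, id, Pi.zero_apply, h2]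
  linarith

lemma eq_zero_of_fromRows_neg_one_mulVec {κ : Type*} {M : Matrix κ (Fin l) ℝ} {y : Fin l → ℝ}
    (h : fromRows M (-1 : Matrix (Fin l) (Fin l) ℝ) *ᵥ y = 0) : y = 0 := by
  rw [fromRows_mulVec, neg_mulVec, one_mulVec] at h
  ext t
  simpa using congrFun h (Sum.inr t)

lemma solutionKernel_mulVec (X : Matrix (Fin k ⊕ Fin p) (Fin l) ℝ) (y : Fin l → ℝ) :
    solutionKernel X *ᵥ y = Sum.elim (fun s => (X *ᵥ y) (Sum.inl s))
      (Sum.elim (fun s => (X *ᵥ y) (Sum.inr s)) (-y)) := by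
  rw [solutionKernel, fromRows_mulVec, fromRows_mulVec, neg_mulVec, one_mulVec]
  rfl

lemma eq_zero_of_solutionKernel_mulVec {X : Matrix (Fin k ⊕ Fin p) (Fin l) ℝ} {y : Fin l → ℝ}
    (h : solutionKernel X *ᵥ y = 0) : y = 0 := by
  rw [solutionKernel_mulVec] at h
  ext t
  simpa using congrFun h (Sum.inr (Sum.inr t))

lemma rank_upperRows_rowsC {j : ℕ} {A : ℕ → Fin k ⊕ Fin p → ℝ} (B : ℕ → Fin l → ℝ)
    (h : (upperRows j A).rank = j) : (upperRows j (rowsC A B)).rank = j := by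
  refine le_antisymm (by simpa using rank_le_card_height (upperRows j (rowsC A B))) ?_
  have h1 : upperRows j A = upperRows j (rowsC A B) *
      (1 : Matrix (Fin k ⊕ (Fin p ⊕ Fin l)) (Fin k ⊕ (Fin p ⊕ Fin l)) ℝ).submatrix id
        (Sum.elim Sum.inl fun s => Sum.inr (Sum.inl s)) := by
    ext i s
    rw [Matrix.mul_apply]
    rcases s with s | s <;> simp [one_apply, upperRows, rowsC]
  conv_lhs => rw [← h, h1]
  exact rank_mul_le_left _ _

/-- The normalized shifted Gram matrix converges to the noise-free limit `S`. -/
lemma tendsto_matF (hl : 0 < l) {X : Matrix (Fin k ⊕ Fin p) (Fin l) ℝ} {ρ : ℕ → Type*}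
    [∀ m, Fintype (ρ m)] {C : ∀ m, Matrix (ρ m) (Fin k ⊕ (Fin p ⊕ Fin l)) ℝ}
    {S : Matrix (Fin k ⊕ (Fin p ⊕ Fin l)) (Fin k ⊕ (Fin p ⊕ Fin l)) ℝ} {τ : ℝ} {mu : ℕ → ℝ}
    (hS : S.PosSemidef) (hS₁₁ : S.toBlocks₁₁.PosDef) (hSX : S * solutionKernel X = 0)
    (hC : Tendsto (fun m : ℕ => (m : ℝ)⁻¹ • ((C m)ᵀ * C m)) atTop
      (𝓝 (S + τ • fromBlocks 0 0 0 1)))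
    (hmu : ∀ᶠ m in atTop, IsShift hl (matG (C m)) (mu m)) :
    Tendsto (fun m : ℕ => (m : ℝ)⁻¹ • matF (C m) (mu m)) atTop (𝓝 S) := by
  have hS₂₁ : S.toBlocks₂₁ = S.toBlocks₁₂ᴴ := by
    have := congrArg toBlocks₂₁ hS.isHermitian
    exact this.symm
  have hdet : IsUnit S.toBlocks₁₁.det := hS₁₁.det_pos.ne'.isUnit
  have hinst : Invertible S.toBlocks₁₁ := invertibleOfIsUnitDet _ hdet
  let G₀ := S.toBlocks₂₂ - S.toBlocks₂₁ * S.toBlocks₁₁⁻¹ * S.toBlocks₁₂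
  have hG₀ : G₀.PosSemidef := by
    have h1 := (PosDef.fromBlocks₁₁ S.toBlocks₁₂ S.toBlocks₂₂ hS₁₁).1 (by
      rw [← hS₂₁, fromBlocks_toBlocks]; exact hS)
    rwa [← hS₂₁] at h1
  let W₁ := X.submatrix (Sum.inl : Fin k → _) id
  let W₂ := fromRows (X.submatrix (Sum.inr : Fin p → _) id) (-1 : Matrix (Fin l) (Fin l) ℝ)
  have hW : fromBlocks S.toBlocks₁₁ S.toBlocks₁₂ S.toBlocks₂₁ S.toBlocks₂₂ * fromRows W₁ W₂ = 0 := by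
    rw [fromBlocks_toBlocks]; exact hSX
  rw [fromBlocks_mul_fromRows] at hW
  have hW1 : S.toBlocks₁₁ * W₁ + S.toBlocks₁₂ * W₂ = 0 := congrArg toRows₁ hW
  have hW2 : S.toBlocks₂₁ * W₁ + S.toBlocks₂₂ * W₂ = 0 := congrArg toRows₂ hW
  -- Block elimination: the first block row of S W = 0 expresses `S.toBlocks₁₂ * W₂` through `W₁`,
  -- and the second then gives zero.
  have hGW : G₀ * W₂ = 0 := by
    have h1 : S.toBlocks₁₂ * W₂ = -(S.toBlocks₁₁ * W₁) := eq_neg_of_add_eq_zero_right hW1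
    simp only [G₀]
    rw [Matrix.sub_mul, Matrix.mul_assoc _ S.toBlocks₁₂, h1, Matrix.mul_neg, Matrix.mul_assoc,
      nonsing_inv_mul_cancel_left _ _ hdet, sub_neg_eq_add, add_comm, hW2]
  have hG := tendsto_matG hC (by
    simpa [toBlocks₁₁] using hdet)
  -- The noise changes only the lower right block, so it passes through the Schur complement as a
  -- multiple of the identity.
  have hGlim : (S + τ • fromBlocks 0 0 0 1).toBlocks₂₂ - (S + τ • fromBlocks 0 0 0 1).toBlocks₂₁ *
      (S + τ • fromBlocks 0 0 0 1).toBlocks₁₁⁻¹ * (S + τ • fromBlocks 0 0 0 1).toBlocks₁₂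
      = G₀ + τ • 1 := by
    have h11 : (S + τ • fromBlocks 0 0 0 1).toBlocks₁₁ = S.toBlocks₁₁ := by
      ext; simp [toBlocks₁₁]
    have h12 : (S + τ • fromBlocks 0 0 0 1).toBlocks₁₂ = S.toBlocks₁₂ := by
      ext; simp [toBlocks₁₂]
    have h21 : (S + τ • fromBlocks 0 0 0 1).toBlocks₂₁ = S.toBlocks₂₁ := by
      ext; simp [toBlocks₂₁]
    have h22 : (S + τ • fromBlocks 0 0 0 1).toBlocks₂₂ = S.toBlocks₂₂ + τ • 1 := by
      ext; simp [toBlocks₂₂]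
    rw [h11, h12, h21, h22, add_sub_right_comm]
  rw [hGlim] at hG
  have hmulim := tendsto_shift hl (fun m => transpose_matG (C m)) hG
    (fun v => by simpa using hG₀.dotProduct_mulVec_nonneg v) (W := W₂)
    (fun y hy => eq_zero_of_fromRows_neg_one_mulVec hy)
    (fun y => by rw [mulVec_mulVec, hGW, zero_mulVec]) hmu
  have h1 := hC.sub (hmulim.smul_const
    (fromBlocks 0 0 0 1 : Matrix (Fin k ⊕ (Fin p ⊕ Fin l)) (Fin k ⊕ (Fin p ⊕ Fin l)) ℝ))
  rw [add_sub_cancel_right] at h1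
  refine h1.congr fun m => ?_
  rw [matF_eq, smul_sub, smul_smul]

/-- On the Ritz space the residual `U + X * L` is small against the whole vector, whose norm is
controlled by the residual and `L` together; absorbing the residual leaves a bound by `L` alone. -/
lemma eventually_sq_error_le {d : ℕ} {X : Matrix (Fin k ⊕ Fin p) (Fin l) ℝ}
    {S : Matrix (Fin k ⊕ (Fin p ⊕ Fin l)) (Fin k ⊕ (Fin p ⊕ Fin l)) ℝ}
    {P : Matrix (Fin k ⊕ (Fin p ⊕ Fin l)) (Fin (l + d)) ℝ} {F : ℕ → Matrix _ _ ℝ}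
    {Zt : ℕ → Matrix (Fin (l + d)) (Fin l) ℝ} {W : Matrix (Fin (l + d)) (Fin l) ℝ}
    (hS : S.PosSemidef) (hSX : S * solutionKernel X = 0) (hP : Pᵀ * P = 1)
    (hPW : P * W = solutionKernel X) (hrank : (Pᵀ * S * P).rank = d)
    (hsymm : ∀ m, (F m)ᵀ = F m)
    (hF : Tendsto (fun m : ℕ => (m : ℝ)⁻¹ • F m) atTop (𝓝 S))
    (hZ : ∀ᶠ m in atTop, IsRitzCoordinates (F m) P (Zt m)) {δ : ℝ} (hδ : 0 < δ) :
    ∀ᶠ m in atTop, IsUnit (lowerPart (P * Zt m)).det ∧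
      ∀ s t, (estimator (P * Zt m) s t - X s t) ^ 2 ≤ δ := by
  let U : Matrix (Fin k ⊕ Fin p) (Fin (l + d)) ℝ :=
    P.submatrix (Sum.elim Sum.inl fun s => Sum.inr (Sum.inl s)) id
  let L : Matrix (Fin l) (Fin (l + d)) ℝ := P.submatrix (fun s => Sum.inr (Sum.inr s)) id
  have hPinj : ∀ v, P *ᵥ v = 0 → v = 0 := fun v hv => by
    rw [← one_mulVec v, ← hP, ← mulVec_mulVec, hv, mulVec_zero]
  have hWinj : ∀ y, W *ᵥ y = 0 → y = 0 := fun y hy =>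
    eq_zero_of_solutionKernel_mulVec (X := X) (by rw [← hPW, ← mulVec_mulVec, hy, mulVec_zero])
  have hKW : Pᵀ * S * P * W = 0 := by
    rw [Matrix.mul_assoc, hPW, Matrix.mul_assoc, hSX, Matrix.mul_zero]
  have hK : (Pᵀ * S * P).PosSemidef := by
    rw [← conjTranspose_eq_transpose_of_trivial]
    exact hS.conjTranspose_mul_mul_same P
  have hUL : ∀ v, (U + X * L) *ᵥ v = 0 → L *ᵥ v = 0 → v = 0 := by
    intro v h1 h2
    rw [add_mulVec, ← mulVec_mulVec, h2, mulVec_zero, add_zero] at h1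
    refine hPinj v ?_
    ext s
    rcases s with s | s | s
    · exact congrFun h1 (Sum.inl s)
    · exact congrFun h1 (Sum.inr s)
    · exact congrFun h2 s
  -- By the rank condition `v = W *ᵥ y`; there `U` gives `X *ᵥ y` and `L` gives `-y`.
  have hker : ∀ v, (Pᵀ * S * P) *ᵥ v = 0 → (U + X * L) *ᵥ v = 0 := by
    intro v hv
    obtain ⟨y, rfl⟩ := exists_mulVec_eq_of_rank_add_card hWinj hKW
      (by rw [hrank, Fintype.card_fin, Fintype.card_fin, add_comm]) hv
    have h1 := solutionKernel_mulVec X y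
    rw [← hPW, ← mulVec_mulVec] at h1
    have hU : U *ᵥ (W *ᵥ y) = X *ᵥ y := by
      ext s
      rcases s with s | s
      · exact congrFun h1 (Sum.inl s)
      · exact congrFun h1 (Sum.inr (Sum.inl s))
    have hL : L *ᵥ (W *ᵥ y) = -y := by
      ext s
      exact congrFun h1 (Sum.inr (Sum.inr s))
    rw [add_mulVec, ← mulVec_mulVec _ X L, hL, hU, mulVec_neg, add_neg_cancel]
  obtain ⟨c₁, hc₁, h₁⟩ := exists_mulVec_dotProduct_le_of_ker_le hK hker
  have hquad : ∀ v, v ⬝ᵥ ((U + X * L)ᵀ * (U + X * L) + Lᵀ * L) *ᵥ v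
      = (U + X * L) *ᵥ v ⬝ᵥ (U + X * L) *ᵥ v + L *ᵥ v ⬝ᵥ L *ᵥ v := fun v => by
    rw [add_mulVec, dotProduct_add, ← mulVec_mulVec, ← mulVec_mulVec, dotProduct_mulVec v,
      dotProduct_mulVec v, vecMul_transpose, vecMul_transpose]
  obtain ⟨c₂, hc₂, h₂⟩ := exists_mulVec_dotProduct_le_of_ker_le
    (K := (U + X * L)ᵀ * (U + X * L) + Lᵀ * L) (L := (1 : Matrix (Fin (l + d)) _ ℝ))
    (by
      rw [← conjTranspose_eq_transpose_of_trivial, ← conjTranspose_eq_transpose_of_trivial]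
      exact (posSemidef_conjTranspose_mul_self _).add (posSemidef_conjTranspose_mul_self _))
    (fun v hv => by
      have h3 := hquad v
      rw [hv, dotProduct_zero] at h3
      have h4 := dotProduct_self_nonneg ((U + X * L) *ᵥ v)
      have h5 := dotProduct_self_nonneg (L *ᵥ v)
      rw [one_mulVec]
      exact hUL v (dotProduct_self_eq_zero.1 (by linarith)) (dotProduct_self_eq_zero.1 (by linarith)))
  simp only [hquad, one_mulVec] at h₂
  -- From `a ≤ r * (a + b)`, the bound 2r ≤ 1 absorbs `a` and 2r ≤ δ leaves `a ≤ δ * b`. In the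
  -- threshold below, `+ 1` covers vanishing `c₁` or `c₂`.
  let r := min δ 1 / 2
  have hr : 0 < r := half_pos (lt_min hδ one_pos)
  have hε : 0 < r / ((c₁ + 1) * (c₂ + 1)) := by positivity
  filter_upwards [hZ, eventually_ritz_le hsymm hF hWinj
    (fun y => by rw [mulVec_mulVec, hKW, zero_mulVec]) hZ hε] with m hm h₃
  refine isUnit_det_and_sq_error_le (U := U) (L := L) (Z := Zt m)
    (fun y hy => hm.mulVec_ne_zero hy) hUL fun y => ?_
  have h4 := h₁ (Zt m *ᵥ y)
  have h5 := h₂ (Zt m *ᵥ y)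
  have h6 := h₃ y
  have h7 := dotProduct_self_nonneg (L *ᵥ (Zt m *ᵥ y))
  have h8 := dotProduct_self_nonneg ((U + X * L) *ᵥ (Zt m *ᵥ y))
  generalize (U + X * L) *ᵥ (Zt m *ᵥ y) ⬝ᵥ (U + X * L) *ᵥ (Zt m *ᵥ y) = a at *
  generalize L *ᵥ (Zt m *ᵥ y) ⬝ᵥ L *ᵥ (Zt m *ᵥ y) = b at *
  have h9 : c₁ * (r / ((c₁ + 1) * (c₂ + 1)) * c₂) ≤ r := by
    rw [div_mul_eq_mul_div, mul_div_assoc', div_le_iff₀ (by positivity)]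
    nlinarith [mul_nonneg hr.le hc₁, mul_nonneg hr.le hc₂]
  have h10 : a ≤ r * (a + b) := calc
    a ≤ c₁ * (r / ((c₁ + 1) * (c₂ + 1)) * (c₂ * (a + b))) :=
      h4.trans (mul_le_mul_of_nonneg_left (h6.trans (mul_le_mul_of_nonneg_left h5 hε.le)) hc₁)
    _ = c₁ * (r / ((c₁ + 1) * (c₂ + 1)) * c₂) * (a + b) := by ring
    _ ≤ r * (a + b) := mul_le_mul_of_nonneg_right h9 (by linarith)
  have h11 : 2 * r ≤ δ := by simp only [r]; linarith [min_le_left δ 1]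
  have h12 : 2 * r ≤ 1 := by simp only [r]; linarith [min_le_right δ 1]
  have h13 := mul_le_mul_of_nonneg_right h11 h7
  have h14 := mul_le_mul_of_nonneg_right h12 h8
  linarith

end Model

end EIV

/-- Strong consistency of the projection estimator. `m` is the total number of rows, of which the
first `j` are noise-free, as are the first `k` of the `n` columns of `A`. The null space of the
noise-free rows has dimension `n + l - j`, written as `l + (n - j)`. -/
theorem mainTheorem1 {Ω : Type*} [MeasurableSpace Ω] (Pr : Measure Ω) [IsProbabilityMeasure Pr]
    (n k j l : ℕ) (_hk : k ≤ n) (_hj : j < n) (hl : 0 < l)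
    -- the regression model `Ā X = B̄`, row by row
    (X : Matrix (Fin k ⊕ Fin (n - k)) (Fin l) ℝ)
    (Abar : ℕ → Fin k ⊕ Fin (n - k) → ℝ) (Bbar : ℕ → Fin l → ℝ)
    (_hmodel : ∀ i, Abar i ᵥ* X = Bbar i)
    (_hrank : (EIV.upperRows j Abar).rank = j)
    -- the noise
    (e : ℕ → Ω → Fin (n - k) ⊕ Fin l → ℝ) (σ : ℝ)
    (_hE : EIV.NoiseAssumption Pr e σ)
    -- an orthonormal basis of the null space of the noise-free rows
    (P : Matrix (Fin k ⊕ (Fin (n - k) ⊕ Fin l)) (Fin (l + (n - j))) ℝ)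
    (_hPorth : Pᵀ * P = 1)
    (_hPnull : EIV.upperRows j (EIV.rowsC Abar Bbar) * P = 0)
    (_hlim : EIV.LimitAssumption j (n - j) (EIV.rowsC Abar Bbar) P)
    -- any choice, for large `m`, of the shift `μ` and of the Ritz vectors
    (mu : ℕ → Ω → ℝ) (Zt : ℕ → Ω → Matrix (Fin (l + (n - j))) (Fin l) ℝ)
    (_hmu : ∀ᵐ ω ∂Pr, ∀ᶠ m in atTop,
      EIV.IsShift hl
        (EIV.matG (EIV.observedLower j m (EIV.rowsC Abar Bbar) (fun i => e i ω))) (mu m ω))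
    (_hZt : ∀ᵐ ω ∂Pr, ∀ᶠ m in atTop,
      EIV.IsRitzCoordinates
        (EIV.matF (EIV.observedLower j m (EIV.rowsC Abar Bbar) (fun i => e i ω)) (mu m ω))
        P (Zt m ω)) :
    ∀ᵐ ω ∂Pr,
      (∀ᶠ m in atTop, IsUnit (EIV.lowerPart (P * Zt m ω)).det) ∧
      Tendsto (fun m => EIV.estimator (P * Zt m ω)) atTop (𝓝 X) := by
  obtain ⟨⟨T, hT, hTpos⟩, S, hS, hSrank⟩ := _hlim
  let W := EIV.solutionKernel X
  have hCW : ∀ i, EIV.rowsC Abar Bbar i ᵥ* W = 0 := EIV.rowsC_vecMul_solutionKernel _hmodel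
  have hS0 : S.PosSemidef := EIV.posSemidef_of_tendsto_gram hS
  have hS₁₁ : S.toBlocks₁₁.PosDef := by
    have hc : Continuous fun M : Matrix (Fin k ⊕ (Fin (n - k) ⊕ Fin l))
        (Fin k ⊕ (Fin (n - k) ⊕ Fin l)) ℝ => M.toBlocks₁₁ := continuous_id.matrix_submatrix _ _
    have h1 : T = S.toBlocks₁₁ := tendsto_nhds_unique hT ((hc.tendsto S).comp hS)
    rwa [← h1]
  have hSX : S * W = 0 := by
    refine tendsto_nhds_unique (EIV.tendsto_matrix_mul hS (tendsto_const_nhds (x := W)))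
      (tendsto_const_nhds.congr fun m => ?_)
    have h1 : EIV.lowerRows j m (EIV.rowsC Abar Bbar) * W = 0 := by
      ext i t
      exact congrFun (hCW (j + i)) t
    rw [smul_mul, Matrix.mul_assoc, h1, Matrix.mul_zero, smul_zero]
  -- The noise-free rows annihilate W, and their kernel is the range of P by the count j + (l + (n -
  -- j)) = n + l; on that range P Pᵀ is the identity.
  have hPW : P * (Pᵀ * W) = W := by
    refine Matrix.ext_of_mulVec_single fun t => ?_
    have hPinj : ∀ v, P *ᵥ v = 0 → v = 0 := fun v hv => by
      rw [← one_mulVec v, ← _hPorth, ← mulVec_mulVec, hv, mulVec_zero]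
    have hU : EIV.upperRows j (EIV.rowsC Abar Bbar) * W = 0 := by
      ext i s
      exact congrFun (hCW i) s
    obtain ⟨z, hz⟩ := EIV.exists_mulVec_eq_of_rank_add_card hPinj _hPnull
      (by
        rw [EIV.rank_upperRows_rowsC Bbar _hrank]
        simp only [Fintype.card_fin, Fintype.card_sum]
        omega)
      (v := W *ᵥ Pi.single t 1) (by rw [mulVec_mulVec, hU, zero_mulVec])
    rw [← mulVec_mulVec, ← mulVec_mulVec, ← hz, mulVec_mulVec z, _hPorth, one_mulVec]
  filter_upwards [_hE.ae_tendsto_gram hS, _hmu, _hZt] with ω hgram hmu hZ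
  have hF := EIV.tendsto_matF hl hS0 hS₁₁ hSX hgram hmu
  have hev : ∀ δ : ℝ, 0 < δ → _ := fun δ hδ =>
    EIV.eventually_sq_error_le hS0 hSX _hPorth hPW hSrank (fun m => EIV.transpose_matF _ _) hF hZ hδ
  refine ⟨(hev 1 one_pos).mono fun m hm => hm.1, ?_⟩
  refine tendsto_pi_nhds.2 fun s => tendsto_pi_nhds.2 fun t => Metric.tendsto_nhds.2 fun η hη => ?_
  filter_upwards [hev ((η / 2) ^ 2) (by positivity)] with m hm
  have h1 := abs_le_of_sq_le_sq (hm.2 s t) (half_pos hη).le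
  rw [Real.dist_eq]
  exact h1.trans_lt (half_lt_self hη)
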